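/- Let $R$ be a commutative ring and let $X_1,\dots,X_n,x_1,\dots,x_n,P_1,\dots,P_n,p_1,\dots,p_n\in R$ (for instance, the variables of a polynomial ring over a field $k$). Put $x_{ij}=X_ix_j-X_jx_i$ and $p_{ij}=P_ip_j-P_jp_i$. Let $B=\{b_1<\dots<b_{2s}\}\subseteq\{1,\dots,n\}$ be a set of even size $2s$ with $s\ge 0$, and let $\Psi_B(x,p)$ be the determinant of the $2s\times 2s$ matrix whose $m$-th row is $$\bigl(x_{b_m}p_{b_m}^{s-1},\;x_{b_m}p_{b_m}^{s-2}P_{b_m},\;\dots,\;x_{b_m}P_{b_m}^{s-1},\;X_{b_m}p_{b_m}^{s-1},\;X_{b_m}p_{b_m}^{s-2}P_{b_m},\;\dots,\;X_{b_m}P_{b_m}^{s-1}\bigr)$$ (so $\Psi_\emptyset(x,p)=1$). Then for every sequence $i_1,\dots,i_s$ of distinct elements of $B$, there are exactly $s!$ permutations $\sigma$ of $B$ that satisfy $\sigma(b_m)=i_m$ for $1\le m\le s$, and $$\Psi_B(x,p)=(-1)^{s(s+1)/2}\sum_{\sigma}\operatorname{sgn}(\sigma)\prod_{r=1}^{s}\Bigl(x_{i_rj_r}\prod_{m\ne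 r}p_{i_rj_m}\Bigr),$$ where the sum is over these permutations, $j_m:=\sigma(b_{s+m})$, and $m$ in the inner product runs over $\{1,\dots,s\}\setminus\{r\}$. -/

import Mathlib

namespace BiPlucker

/-- The `2 × 2` minor `a_{ij} = A_i a_j - A_j a_i` of the `2 × n` matrix with rows `A` and `a`. -/
def minor {R : Type*} [CommRing R] {n : ℕ} (A a : Fin n → R) (i j : Fin n) : R :=
  A i * a j - A j * a i

/-- The increasing enumeration `b_1 < ⋯ < b_{2s}` of the elements of `B`. The first `s` elements
are the values at `Fin.castAdd s m`, the last `s` are the values at `Fin.natAdd s m`. -/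
def enum {n s : ℕ} (B : Finset (Fin n)) (hB : B.card = s + s) (m : Fin (s + s)) : B :=
  B.orderIsoOfFin hB m

/-- The `2s × 2s` matrix `V_B` whose row at `b = b_m` is
`(x_b p_b^{s-1}, x_b p_b^{s-2} P_b, …, x_b P_b^{s-1}, X_b p_b^{s-1}, X_b p_b^{s-2} P_b, …,
X_b P_b^{s-1})`. -/
def matV {R : Type*} [CommRing R] {n s : ℕ} (X x P p : Fin n → R)
    (B : Finset (Fin n)) (hB : B.card = s + s) : Matrix (Fin (s + s)) (Fin (s + s)) R :=
  Matrix.of fun m c =>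
    Fin.addCases (motive := fun _ => R)
      (fun k : Fin s => x (enum B hB m) * p (enum B hB m) ^ (s - 1 - (k : ℕ)) *
        P (enum B hB m) ^ (k : ℕ))
      (fun k : Fin s => X (enum B hB m) * p (enum B hB m) ^ (s - 1 - (k : ℕ)) *
        P (enum B hB m) ^ (k : ℕ)) c

/-- The determinant `Ψ_B(X, x, P, p)`, abbreviated `Ψ_B(x, p)`. -/
def Psi {R : Type*} [CommRing R] {n s : ℕ} (X x P p : Fin n → R)
    (B : Finset (Fin n)) (hB : B.card = s + s) : R :=
  (matV X x P p B hB).det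

/-- The permutations `σ` of `B` with `σ(b_m) = i_m` for `1 ≤ m ≤ s`. -/
def permsExtending {n s : ℕ} (B : Finset (Fin n)) (hB : B.card = s + s) (i : Fin s → B) :
    Finset (Equiv.Perm B) :=
  {σ : Equiv.Perm B | ∀ m : Fin s, σ (enum B hB (Fin.castAdd s m)) = i m}

/-- The elements `j_m = σ(b_{s+m})` of `B`. -/
def jSeq {n s : ℕ} (B : Finset (Fin n)) (hB : B.card = s + s) (σ : Equiv.Perm B) (m : Fin s) : B :=
  σ (enum B hB (Fin.natAdd s m))

end BiPlucker

namespace BiPlucker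

open Matrix Finset

/-! Reorder the rows of V_B by one admissible σ₀, so that i_1,…,i_s come first and j_1,…,j_s last;
this costs sgn(σ₀). Let C hold the coefficients of the s forms ∏_{m≠c} (P p_{j_m} − P_{j_m} p). Each
vanishes at every j-row except the c-th, so multiplying both column blocks by C makes the lower
blocks diagonal. Clearing the lower left one leaves −(x_{i_r j_c} ∏_{m≠c} p_{i_r j_m}) at the upper
left (`det_blockV_of_ne_zero`). The factor det(C)² cancels up to sign, because C inverts a
projective Vandermonde matrix up to a diagonal factor. This proves the identity generically, hence
over every ring (`det_blockV`). Expanding the s × s determinant gives a sum over reorderings τ of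
the j's, which parametrize the admissible σ (`sum_permsExtending`). -/

/-- A product of `d` linear forms in two variables is a binary form of degree `d`. -/
theorem exists_coeff_prod_linear {R ι : Type*} [CommRing R] (S : Finset ι) (a b : ι → R) :
    ∃ c : ℕ → R, ∀ P p : R, ∏ t ∈ S, (P * a t - b t * p) =
      ∑ k ∈ range (S.card + 1), p ^ (S.card - k) * P ^ k * c k := by
  classical
  induction S using Finset.induction_on with
  | empty => exact ⟨fun _ => 1, fun P p => by simp⟩
  | insert t S ht ih =>
    obtain ⟨c, hc⟩ := ih
    -- Multiplying by `P * a t` shifts the coefficients by one, while `b t * p` keeps their index;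
    -- the two `if`s discard the missing end terms.
    refine ⟨fun k => (if k = 0 then 0 else a t * c (k - 1)) -
      (if k = S.card + 1 then 0 else b t * c k), fun P p => ?_⟩
    rw [prod_insert ht, hc, card_insert_of_notMem ht]
    simp only [mul_sub, sum_sub_distrib]
    rw [sum_range_succ' (fun k => p ^ (S.card + 1 - k) * P ^ k *
        (if k = 0 then 0 else a t * c (k - 1))) (S.card + 1),
      sum_range_succ (fun k => p ^ (S.card + 1 - k) * P ^ k *
        (if k = S.card + 1 then 0 else b t * c k)) (S.card + 1)]
    simp only [sub_mul, mul_sum, if_true, mul_zero, add_zero]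
    rw [← sum_sub_distrib]
    refine sum_congr rfl fun k hk => ?_
    have hk' : k < S.card + 1 := mem_range.1 hk
    simp only [Nat.add_sub_add_right, Nat.add_eq_zero_iff, one_ne_zero, and_false, if_false,
      Nat.add_sub_cancel]
    rw [if_neg hk'.ne, Nat.succ_sub (Nat.lt_succ_iff.1 hk'), pow_succ p (S.card - k),
      pow_succ P k]
    ring

/-- The matrix `V_B` with rows indexed by `Fin s ⊕ Fin s`, in block form. -/
def blockV {R : Type*} [CommRing R] {s : ℕ} (X x P p : Fin s ⊕ Fin s → R) :
    Matrix (Fin s ⊕ Fin s) (Fin s ⊕ Fin s) R :=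
  Matrix.of fun b => Sum.elim (fun k => x b * p b ^ (s - 1 - (k : ℕ)) * P b ^ (k : ℕ))
    (fun k => X b * p b ^ (s - 1 - (k : ℕ)) * P b ^ (k : ℕ))

/-- The matrix with entries `x_{ij} ∏_{j' ≠ j} p_{ij'}`. -/
def minorMatrix {R : Type*} [CommRing R] {s : ℕ} (X x P p : Fin s ⊕ Fin s → R) :
    Matrix (Fin s) (Fin s) R :=
  Matrix.of fun r c => (X (.inl r) * x (.inr c) - X (.inr c) * x (.inl r)) *
    ∏ m ∈ univ.erase c, (P (.inl r) * p (.inr m) - P (.inr m) * p (.inl r))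

/-- Multiplying by the coefficients of the forms `∏_{c' ≠ c} (P p_{c'} - P_{c'} p)` evaluates
them at the rows of a projective Vandermonde matrix. -/
theorem exists_mul_eq_prod_erase {R : Type*} [CommRing R] {s : ℕ} (P p : Fin s → R) :
    ∃ C : Matrix (Fin s) (Fin s) R, ∀ (u v : R) (c : Fin s),
      ∑ k : Fin s, v ^ (s - 1 - (k : ℕ)) * u ^ (k : ℕ) * C k c =
        ∏ m ∈ univ.erase c, (u * p m - P m * v) := by
  choose f hf using fun c : Fin s => exists_coeff_prod_linear (univ.erase c) p P
  refine ⟨Matrix.of fun k c => f c k, fun u v c => ?_⟩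
  have hs : (univ.erase c).card = s - 1 := by simp
  have hpos : s - 1 + 1 = s := Nat.sub_add_cancel (Nat.lt_of_le_of_lt (Nat.zero_le _) c.2)
  rw [hf, hs, hpos, ← Fin.sum_univ_eq_sum_range (fun k => v ^ (s - 1 - k) * u ^ k * f c k)]
  rfl

/-- The factors for (c, m) and (m, c) are opposite, so each of the s(s−1)/2 unordered pairs
contributes minus a square. -/
theorem prod_prod_erase_minor {R : Type*} [CommRing R] {s : ℕ} (P p : Fin s → R) :
    ∏ c, ∏ m ∈ univ.erase c, (P c * p m - P m * p c) =
      (-1) ^ (s * (s - 1) / 2) * (projVandermonde P p).det ^ 2 := by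
  have h1 : ∀ c : Fin s, univ.erase c = {c}ᶜ := fun c => by ext; simp
  simp only [h1]
  have := prod_prod_Ioi_mul_eq_prod_prod_off_diag (fun m c : Fin s => P c * p m - P m * p c)
  rw [← this, det_projVandermonde, sq]
  have h2 : ∀ i j : Fin s, (P i * p j - P j * p i) * (P j * p i - P i * p j) =
      (-1) * ((P j * p i - P i * p j) * (P j * p i - P i * p j)) := fun i j => by ring
  simp only [h2, prod_mul_distrib, prod_const]
  rw [prod_pow_eq_pow_sum]
  congr 2
  simp only [Fin.card_Ioi]
  rw [Fin.sum_univ_eq_sum_range (fun k => s - 1 - k), sum_range_reflect (fun k => k),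
    sum_range_id]

theorem det_blockV_of_ne_zero {R : Type*} [CommRing R] [IsDomain R] {s : ℕ}
    (X x P p : Fin s ⊕ Fin s → R) (hX : ∀ c, X (.inr c) ≠ 0)
    (hP : ∀ a b, a ≠ b → P (.inr a) * p (.inr b) - P (.inr b) * p (.inr a) ≠ 0) :
    (blockV X x P p).det = (-1) ^ (s * (s + 1) / 2) * (minorMatrix X x P p).det := by
  obtain ⟨C, hC⟩ := exists_mul_eq_prod_erase (fun c => P (.inr c)) (fun c => p (.inr c))
  set D : Fin s → R := fun c =>
    ∏ m ∈ univ.erase c, (P (.inr c) * p (.inr m) - P (.inr m) * p (.inr c)) with hD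
  set W := projVandermonde (fun c => P (.inr c)) (fun c => p (.inr c)) with hW
  set N : Matrix (Fin s) (Fin s) R := Matrix.of fun r c =>
    ∏ m ∈ univ.erase c, (P (.inl r) * p (.inr m) - P (.inr m) * p (.inl r)) with hN
  have hD0 : ∀ c, D c ≠ 0 := fun c =>
    prod_ne_zero_iff.2 fun m hm => hP _ _ (ne_of_mem_erase hm).symm
  have hoff : ∀ r c, r ≠ c →
      ∏ m ∈ univ.erase c, (P (.inr r) * p (.inr m) - P (.inr m) * p (.inr r)) = 0 :=
    fun r c h => prod_eq_zero (mem_erase.2 ⟨h, mem_univ r⟩) (sub_self _)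
  have hWC : W * C = diagonal D := by
    ext r c
    have : (W * C) r c = ∏ m ∈ univ.erase c,
        (P (.inr r) * p (.inr m) - P (.inr m) * p (.inr r)) := by
      rw [← hC, mul_apply]
      refine sum_congr rfl fun k _ => ?_
      rw [hW, projVandermonde_apply, Fin.val_rev, mul_comm (p _ ^ _), Nat.sub_sub, add_comm 1]
    rw [this]
    obtain rfl | h := eq_or_ne r c
    · rw [diagonal_apply_eq]
    · rw [diagonal_apply_ne _ h, hoff r c h]
  have hVC : blockV X x P p * fromBlocks C 0 0 C =
      fromBlocks (diagonal (fun r => x (.inl r)) * N) (diagonal (fun r => X (.inl r)) * N)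
        (diagonal fun c => x (.inr c) * D c) (diagonal fun c => X (.inr c) * D c) := by
    have key : ∀ (y : Fin s ⊕ Fin s → R) b c,
        ∑ k : Fin s, y b * p b ^ (s - 1 - (k : ℕ)) * P b ^ (k : ℕ) * C k c =
          y b * ∏ m ∈ univ.erase c, (P b * p (.inr m) - P (.inr m) * p b) := by
      intro y b c
      rw [← hC, mul_sum]
      exact sum_congr rfl fun k _ => by ring
    have diag : ∀ (y : Fin s ⊕ Fin s → R) r c,
        y (.inr r) * ∏ m ∈ univ.erase c, (P (.inr r) * p (.inr m) - P (.inr m) * p (.inr r)) =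
          diagonal (fun c => y (.inr c) * D c) r c := by
      intro y r c
      obtain rfl | h := eq_or_ne r c
      · rw [diagonal_apply_eq]
      · rw [diagonal_apply_ne _ h, hoff r c h, mul_zero]
    ext (r | r) (c | c) <;>
      simp only [mul_apply, Fintype.sum_sum_type, blockV, of_apply, Sum.elim_inl, Sum.elim_inr,
        fromBlocks_apply₁₁, fromBlocks_apply₁₂, fromBlocks_apply₂₁, fromBlocks_apply₂₂,
        Matrix.zero_apply, mul_zero, sum_const_zero, add_zero, zero_add, key, diag]
    all_goals simp [diagonal_apply, hN]
  -- Column c of the left block becomes X_{j_c} times itself minus x_{j_c} times its right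
  -- counterpart. The scaling multiplies the determinant by ∏ X_{j_c}, which `hX` lets one cancel.
  have helim : fromBlocks (diagonal (fun r => x (.inl r)) * N) (diagonal (fun r => X (.inl r)) * N)
        (diagonal fun c => x (.inr c) * D c) (diagonal fun c => X (.inr c) * D c) *
      fromBlocks (diagonal fun c => X (.inr c)) 0 (-diagonal fun c => x (.inr c)) 1 =
      fromBlocks (-minorMatrix X x P p) (diagonal (fun r => X (.inl r)) * N) 0
        (diagonal fun c => X (.inr c) * D c) := by
    rw [fromBlocks_multiply]
    congr 1
    · ext r c
      simp [minorMatrix, hN, diagonal_mul, mul_diagonal]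
      ring
    · simp
    · ext r c
      obtain rfl | h := eq_or_ne r c
      · simp
        ring
      · simp [h]
    · simp
  have hdet : W.det * C.det = ∏ c, D c := by rw [← det_mul, hWC, det_diagonal]
  have hDW : ∏ c, D c = (-1) ^ (s * (s - 1) / 2) * W.det ^ 2 := prod_prod_erase_minor _ _
  have hXp : ∏ c, X (.inr c) ≠ 0 := prod_ne_zero_iff.2 fun c _ => hX c
  have hDp : ∏ c, D c ≠ 0 := prod_ne_zero_iff.2 fun c _ => hD0 c
  have e1 := congrArg det hVC
  have e2 := congrArg det helim
  rw [det_mul, det_fromBlocks_zero₂₁] at e1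
  rw [det_mul, ← e1, det_fromBlocks_zero₁₂, det_fromBlocks_zero₂₁, det_diagonal, det_diagonal,
    det_one, mul_one, det_neg, Fintype.card_fin, prod_mul_distrib] at e2
  have hsign : (-1 : R) ^ (s * (s + 1) / 2) = (-1) ^ s * (-1) ^ (s * (s - 1) / 2) := by
    rw [← pow_add]
    congr 1
    cases s with
    | zero => rfl
    | succ t =>
      have : (t + 1) * (t + 1 + 1) = (t + 1) * t + (t + 1) * 2 := by ring
      rw [this, Nat.add_mul_div_right _ _ two_pos, Nat.add_sub_cancel, add_comm]
  have e3 : (blockV X x P p).det * (C.det * C.det) =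
      (-1) ^ s * (minorMatrix X x P p).det * ∏ c, D c :=
    mul_right_cancel₀ hXp (by linear_combination e2)
  have hC0 : C.det ≠ 0 := fun h => hDp (by rw [← hdet, h, mul_zero])
  have hsq : ((-1 : R) ^ (s * (s - 1) / 2)) * (-1) ^ (s * (s - 1) / 2) = 1 := by
    rw [← mul_pow]; simp
  -- Both det W · det C and ± (det W)² equal ∏ D, so det C = ± det W.
  have hCD : C.det * C.det = (-1) ^ (s * (s - 1) / 2) * ∏ c, D c := by
    have hW0 : W.det ≠ 0 := fun h => hDp (by rw [← hdet, h, zero_mul])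
    have h4 : C.det = (-1) ^ (s * (s - 1) / 2) * W.det :=
      mul_left_cancel₀ hW0 (by rw [hdet, hDW]; ring)
    rw [← hdet]
    linear_combination C.det * h4
  refine mul_right_cancel₀ hDp ?_
  rw [hsign]
  linear_combination (-1) ^ (s * (s - 1) / 2) * e3 -
    (-1) ^ (s * (s - 1) / 2) * (blockV X x P p).det * hCD -
    (blockV X x P p).det * (∏ c, D c) * hsq

theorem map_minorMatrix {R S : Type*} [CommRing R] [CommRing S] (f : R →+* S) {s : ℕ}
    (X x P p : Fin s ⊕ Fin s → R) :
    f.mapMatrix (minorMatrix X x P p) = minorMatrix (f ∘ X) (f ∘ x) (f ∘ P) (f ∘ p) := by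
  ext r c
  simp [minorMatrix]

theorem map_blockV {R S : Type*} [CommRing R] [CommRing S] (f : R →+* S) {s : ℕ}
    (X x P p : Fin s ⊕ Fin s → R) :
    f.mapMatrix (blockV X x P p) = blockV (f ∘ X) (f ∘ x) (f ∘ P) (f ∘ p) := by
  ext b (c | c) <;> simp [blockV]

/-- Both sides are integer polynomials in the entries, so it suffices to treat independent variables
over ℤ, where the nonvanishing conditions hold, and specialize. -/
theorem det_blockV {R : Type*} [CommRing R] {s : ℕ} (X x P p : Fin s ⊕ Fin s → R) :
    (blockV X x P p).det = (-1) ^ (s * (s + 1) / 2) * (minorMatrix X x P p).det := by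
  let y : Fin 4 → Fin s ⊕ Fin s → MvPolynomial (Fin 4 × (Fin s ⊕ Fin s)) ℤ := fun t b => MvPolynomial.X (t, b)
  let f : MvPolynomial (Fin 4 × (Fin s ⊕ Fin s)) ℤ →+* R :=
    MvPolynomial.eval₂Hom (Int.castRingHom R) fun q => (![X, x, P, p] : Fin 4 → Fin s ⊕ Fin s → R) q.1 q.2
  have hf : ∀ t, f ∘ y t = (![X, x, P, p] : Fin 4 → Fin s ⊕ Fin s → R) t := fun t => by
    ext b
    simp [f, y]
  have h := det_blockV_of_ne_zero (y 0) (y 1) (y 2) (y 3)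
    (fun c => MvPolynomial.X_ne_zero _) fun a b hab h => by
      -- At P_a = p_b = 1 and all other variables 0, the minor takes the value 1.
      have := congrArg (MvPolynomial.eval fun q : Fin 4 × (Fin s ⊕ Fin s) =>
        if q = (2, Sum.inr a) ∨ q = (3, .inr b) then (1 : ℤ) else 0) h
      simp [y, hab] at this
  have h' := congrArg f h
  rw [map_mul, map_pow, map_neg, map_one, RingHom.map_det, RingHom.map_det, map_blockV,
    map_minorMatrix, hf, hf, hf, hf] at h'
  exact h'

/-! ### Permutations extending a partial injection -/

/-- `enum` as an equivalence from `Fin s ⊕ Fin s`. -/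
def enumSum {n s : ℕ} (B : Finset (Fin n)) (hB : B.card = s + s) : Fin s ⊕ Fin s ≃ B :=
  finSumFinEquiv.trans (B.orderIsoOfFin hB).toEquiv

/-- The permutations of `B` extending a given partial injection are parametrized by the
permutations of the last `s` indices, once one of them has been chosen. -/
theorem sum_permsExtending {n s : ℕ} {M : Type*} [AddCommMonoid M] (B : Finset (Fin n))
    (hB : B.card = s + s) (i : Fin s → B) (σ₀ : Equiv.Perm B) (h₀ : σ₀ ∈ permsExtending B hB i)
    (f : Equiv.Perm B → M) :
    ∑ σ ∈ permsExtending B hB i, f σ = ∑ τ : Equiv.Perm (Fin s),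
      f (σ₀ * (enumSum B hB).permCongr (Equiv.Perm.sumCongr 1 τ)) := by
  simp only [permsExtending, mem_filter, mem_univ, true_and] at h₀
  symm
  refine sum_bij (fun τ _ => σ₀ * (enumSum B hB).permCongr (Equiv.Perm.sumCongr 1 τ))
    (fun τ _ => ?_) (fun τ _ τ' _ h => ?_) (fun σ hσ => ?_) (fun _ _ => rfl)
  · simp only [permsExtending, mem_filter, mem_univ, true_and]
    intro m
    rw [← h₀ m, Equiv.Perm.mul_apply]
    congr 1
    have : enum B hB (Fin.castAdd s m) = enumSum B hB (.inl m) := rfl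
    rw [this]
    simp [Equiv.permCongr_apply]
  · have h' := (enumSum B hB).permCongr.injective (mul_left_cancel h)
    ext m
    have := Equiv.congr_fun h' (.inr m)
    simpa using congrArg (fun t => Sum.elim (fun _ => 0) Fin.val t) this
  · simp only [permsExtending, mem_filter, mem_univ, true_and] at hσ
    -- σ₀⁻¹σ fixes the first s indices, so it is the identity there and permutes the last s among
    -- themselves.
    let ρ : Equiv.Perm (Fin s ⊕ Fin s) := (enumSum B hB).symm.permCongr (σ₀⁻¹ * σ)
    have hρ : ∀ m, ρ (.inl m) = .inl m := fun m => by
      change (enumSum B hB).symm (σ₀⁻¹ (σ (enum B hB (Fin.castAdd s m)))) = _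
      rw [hσ, ← h₀, Equiv.Perm.inv_def, Equiv.symm_apply_apply]
      exact (enumSum B hB).symm_apply_apply (.inl m)
    have hmaps : Set.MapsTo ρ (Set.range Sum.inl) (Set.range Sum.inl) := by
      rintro _ ⟨m, rfl⟩
      exact ⟨m, (hρ m).symm⟩
    obtain ⟨⟨τ₁, τ₂⟩, hτ⟩ := Equiv.Perm.mem_sumCongrHom_range_of_perm_mapsTo_inl hmaps
    have hτ₁ : τ₁ = 1 := by
      ext m
      have := hρ m
      rw [← hτ] at this
      simpa using congrArg (fun t => Sum.elim Fin.val (fun _ => 0) t) this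
    subst hτ₁
    refine ⟨τ₂, mem_univ _, ?_⟩
    have : Equiv.Perm.sumCongr 1 τ₂ = ρ := hτ
    rw [this]
    ext b
    simp [ρ, Equiv.permCongr_apply]

theorem exists_mem_permsExtending {n s : ℕ} (B : Finset (Fin n)) (hB : B.card = s + s)
    (i : Fin s → B) (hi : Function.Injective i) : ∃ σ, σ ∈ permsExtending B hB i := by
  obtain ⟨σ, hσ⟩ := Equiv.Perm.exists_extending_pair
    (fun m : Fin s => enum B hB (Fin.castAdd s m)) i
    ((B.orderIsoOfFin hB).injective.comp (Fin.castAdd_injective s s)) hi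
  exact ⟨σ, by simpa [permsExtending] using hσ⟩

theorem card_permsExtending {n s : ℕ} (B : Finset (Fin n)) (hB : B.card = s + s)
    (i : Fin s → B) (hi : Function.Injective i) :
    (permsExtending B hB i).card = s.factorial := by
  obtain ⟨σ₀, h₀⟩ := exists_mem_permsExtending B hB i hi
  rw [card_eq_sum_ones, sum_permsExtending B hB i σ₀ h₀]
  simp [Fintype.card_perm]

/-! ### Passage from Ψ_B to the block form -/

/-- Permuting the rows of `V_B` by `σ` and splitting the indices gives the block form. -/
theorem Psi_eq_sign_mul_det_blockV {R : Type*} [CommRing R] {n s : ℕ} (X x P p : Fin n → R)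
    (B : Finset (Fin n)) (hB : B.card = s + s) (σ : Equiv.Perm B) :
    Psi X x P p B hB = ((Equiv.Perm.sign σ : ℤ) : R) *
      (blockV (fun b => X (σ (enumSum B hB b))) (fun b => x (σ (enumSum B hB b)))
        (fun b => P (σ (enumSum B hB b))) (fun b => p (σ (enumSum B hB b)))).det := by
  set e := enumSum B hB
  have h1 : blockV (fun b => X (σ (e b))) (fun b => x (σ (e b))) (fun b => P (σ (e b)))
      (fun b => p (σ (e b))) =
      ((matV X x P p B hB).submatrix finSumFinEquiv finSumFinEquiv).submatrix
        (e.symm.permCongr σ) id := by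
    have h2 : ∀ b, enum B hB (finSumFinEquiv (e.symm (σ (e b)))) = σ (e b) :=
      fun b => e.apply_symm_apply _
    ext b (c | c) <;>
      simp [blockV, matV, Equiv.permCongr_apply, h2, -Fin.natAdd_eq_addNat]
  rw [h1, det_permute, det_submatrix_equiv_self, Equiv.Perm.sign_permCongr, ← mul_assoc,
    ← Int.cast_mul, Int.units_coe_mul_self, Int.cast_one, one_mul]
  rfl

theorem det_minorMatrix {R : Type*} [CommRing R] {s : ℕ} (X x P p : Fin s ⊕ Fin s → R) :
    (minorMatrix X x P p).det = ∑ τ : Equiv.Perm (Fin s), ((Equiv.Perm.sign τ : ℤ) : R) *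
      ∏ r, ((X (.inl r) * x (.inr (τ r)) - X (.inr (τ r)) * x (.inl r)) *
        ∏ m ∈ univ.erase r, (P (.inl r) * p (.inr (τ m)) - P (.inr (τ m)) * p (.inl r))) := by
  rw [← det_transpose, det_apply']
  refine sum_congr rfl fun τ _ => ?_
  congr 1
  refine prod_congr rfl fun r _ => ?_
  rw [transpose_apply, minorMatrix, of_apply]
  congr 1
  refine (prod_bij (fun m _ => τ m) ?_ ?_ ?_ ?_).symm
  · simp
  · simp
  · exact fun c hc => ⟨τ.symm c, by simpa [Equiv.symm_apply_eq] using hc, by simp⟩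
  · simp

end BiPlucker

theorem mainTheorem6 {R : Type*} [CommRing R] {n s : ℕ} (X x P p : Fin n → R)
    (B : Finset (Fin n)) (hB : B.card = s + s) (i : Fin s → B) (hi : Function.Injective i) :
    (BiPlucker.permsExtending B hB i).card = s.factorial ∧
    BiPlucker.Psi X x P p B hB =
      (-1) ^ (s * (s + 1) / 2) *
        ∑ σ ∈ BiPlucker.permsExtending B hB i, ((Equiv.Perm.sign σ : ℤ) : R) *
          ∏ r : Fin s, (BiPlucker.minor X x (i r) (BiPlucker.jSeq B hB σ r) *
            ∏ m ∈ Finset.univ.erase r, BiPlucker.minor P p (i r) (BiPlucker.jSeq B hB σ m)) := by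
  refine ⟨BiPlucker.card_permsExtending B hB i hi, ?_⟩
  obtain ⟨σ₀, h₀⟩ := BiPlucker.exists_mem_permsExtending B hB i hi
  rw [BiPlucker.sum_permsExtending B hB i σ₀ h₀,
    BiPlucker.Psi_eq_sign_mul_det_blockV X x P p B hB σ₀, BiPlucker.det_blockV,
    BiPlucker.det_minorMatrix, mul_left_comm, Finset.mul_sum]
  congr 1
  refine Finset.sum_congr rfl fun τ _ => ?_
  have hI : ∀ r, σ₀ (BiPlucker.enumSum B hB (.inl r)) = i r :=
    (Finset.mem_filter.1 h₀).2
  have hJ : ∀ m, BiPlucker.jSeq B hB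
      (σ₀ * (BiPlucker.enumSum B hB).permCongr (Equiv.Perm.sumCongr 1 τ)) m =
      σ₀ (BiPlucker.enumSum B hB (.inr (τ m))) := fun m => by
    have : BiPlucker.enum B hB (Fin.natAdd s m) = BiPlucker.enumSum B hB (.inr m) := rfl
    rw [BiPlucker.jSeq, this]
    simp [Equiv.permCongr_apply]
  simp only [hI, hJ, BiPlucker.minor, Equiv.Perm.sign_mul, Equiv.Perm.sign_permCongr,
    Equiv.Perm.sign_sumCongr, Equiv.Perm.sign_one, one_mul, Units.val_mul, Int.cast_mul, mul_assoc]
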